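/- Let $d\ge 1$ be an integer and let $c,C>0$. Call an infinite set $A\subset\mathbb R^d$ well-distributed with constants $c,C$ if $\|a-a'\|\ge c$ for all distinct $a,a'\in A$ and every closed axis-parallel cube of side length $C$ contains a point of $A$; here $\|\cdot\|$ is the Euclidean norm. For $q>0$ let $A_q=A\cap B(0,q)$, where $B(0,q)$ is the open Euclidean ball of radius $q$ centered at the origin, and for $E\subset\mathbb R^d$ let $\Delta(E)=\{\|x-y\|:x,y\in E\}$. Then there is a constant $\kappa>0$, depending only on $d$, $c$ and $C$, such that for every set $A\subset\mathbb R^d$ that is well-distributed with constants $c,C$ and every $q>0$, the set $A_q$ is finite and $$|\Delta(A_q)|\;\ge\;\kappa\,|A_q|^{\frac2d-\frac1{d^2}},$$ where $|\cdot|$ denotes cardinality. -/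

import Mathlib

/-- `IsWellDistributed c C A`: the infinite point set `A` in Euclidean space of dimension `d` is
well-distributed (a Delone set) with constants `c` and `C`. -/
structure IsWellDistributed {d : ℕ} (c C : ℝ) (A : Set (EuclideanSpace ℝ (Fin d))) : Prop where
  infinite : A.Infinite
  /-- Distinct points of `A` are at Euclidean distance at least `c`. -/
  separated : ∀ a ∈ A, ∀ b ∈ A, a ≠ b → c ≤ ‖a - b‖
  /-- Every closed coordinate cube of side length `C` contains a point of `A`. -/
  meets_cubes : ∀ x : EuclideanSpace ℝ (Fin d), ∃ a ∈ A, ∀ i, x i ≤ a i ∧ a i ≤ x i + C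

/-- The truncation of `A` to the Euclidean ball of radius `q` centered at the origin. -/
def truncation {d : ℕ} (A : Set (EuclideanSpace ℝ (Fin d))) (q : ℝ) :
    Set (EuclideanSpace ℝ (Fin d)) :=
  A ∩ Metric.ball 0 q

/-- The set of Euclidean distances determined by `E`. -/
def distanceSet {d : ℕ} (E : Set (EuclideanSpace ℝ (Fin d))) : Set ℝ :=
  {r | ∃ x ∈ E, ∃ y ∈ E, r = ‖x - y‖}

/-! Write `n = |A_q|` and `t = |Δ(A_q)|`; for large `q`, `n` has order `q^d`. Round the points at a
scale `s` and, for each `p`, send `x` to the pair (rounded `x`, distance from `x` to `p`). For a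
fixed distance the rounded points lie near a sphere, so there are `O(t (q/s)^(d-1))` values. A
collision is a pair `x ≠ y` in one cell with `p` on its bisector: there are `O(n s^d)` such pairs,
each with `O(q^(d-1))` choices of `p`. Averaging over `p` gives `n ≲ t (q/s)^(d-1) + s^d q^(d-1)`
(`card_le_card_distances_mul_add`). With `s` a small multiple of `q^(1/d)` the last term is at most
`n/2`, so `t ≳ q^(2-1/d)`, which is the claimed power of `n`. -/

open MeasureTheory Module

/-! ### Packing bounds: balls, spherical shells, bisectors -/

/-- Volume bound for a finite family of disjoint balls contained in a ball. -/
theorem sum_pow_finrank_le_of_disjoint_balls {E ι : Type*} [NormedAddCommGroup E]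
    [NormedSpace ℝ E] [FiniteDimensional ℝ E] (I : Finset ι) (x : ι → E) (r : ι → ℝ)
    (hr : ∀ i ∈ I, 0 < r i) (hd : ∀ i ∈ I, ∀ j ∈ I, i ≠ j → r i + r j ≤ dist (x i) (x j))
    (p : E) {R : ℝ} (hR : 0 < R) (hsub : ∀ i ∈ I, dist (x i) p + r i ≤ R) :
    ∑ i ∈ I, r i ^ finrank ℝ E ≤ R ^ finrank ℝ E := by
  let _ : MeasurableSpace E := borel E
  have : BorelSpace E := ⟨rfl⟩
  let μ : Measure E := Measure.addHaar
  have hpos : μ (Metric.ball (0 : E) 1) ≠ 0 := (Metric.measure_ball_pos μ 0 one_pos).ne'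
  have hfin : μ (Metric.ball (0 : E) 1) ≠ ⊤ := measure_ball_lt_top.ne
  have h1 : μ (⋃ i ∈ I, Metric.ball (x i) (r i)) = ∑ i ∈ I, μ (Metric.ball (x i) (r i)) :=
    measure_biUnion_finset (fun i hi j hj hij => Metric.ball_disjoint_ball (hd i hi j hj hij))
      (fun i _ => measurableSet_ball)
  have h2 : μ (⋃ i ∈ I, Metric.ball (x i) (r i)) ≤ μ (Metric.ball p R) := by
    refine measure_mono (Set.iUnion₂_subset fun i hi => ?_)
    exact Metric.ball_subset_ball' (by linarith [hsub i hi])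
  rw [h1, Measure.addHaar_ball_of_pos μ p hR,
    Finset.sum_congr rfl (fun i hi => Measure.addHaar_ball_of_pos μ (x i) (hr i hi)),
    ← Finset.sum_mul, ENNReal.mul_le_mul_iff_left hpos hfin,
    ← ENNReal.ofReal_sum_of_nonneg (fun i hi => (pow_pos (hr i hi) _).le)] at h2
  exact (ENNReal.ofReal_le_ofReal_iff (by positivity)).1 h2

/-- A `δ`-separated subset of a closed ball of radius `R` has at most `(2R/δ + 1)^dim` points. -/
theorem card_le_of_separated {E : Type*} [NormedAddCommGroup E] [NormedSpace ℝ E]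
    [FiniteDimensional ℝ E] (S : Finset E) {δ R : ℝ} (hδ : 0 < δ) (hR : 0 ≤ R)
    (hS : ∀ x ∈ S, ∀ y ∈ S, x ≠ y → δ ≤ dist x y) (p : E) (hp : ∀ x ∈ S, dist x p ≤ R) :
    (S.card : ℝ) ≤ (2 * R / δ + 1) ^ finrank ℝ E := by
  have h := sum_pow_finrank_le_of_disjoint_balls S id (fun _ => δ / 2) (fun _ _ => by positivity)
    (fun i hi j hj hij => by simpa using hS i hi j hj hij) p (R := R + δ / 2) (by positivity)
    (fun i hi => by simpa using hp i hi)
  rw [Finset.sum_const, nsmul_eq_mul] at h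
  have h2 : 2 * R / δ + 1 = (R + δ / 2) / (δ / 2) := by field_simp
  rw [h2, div_pow, le_div_iff₀ (by positivity)]
  exact h

/-- An `s`-separated set within distance `s` of a sphere of radius `r` has
`O((M/s)^(dim - 1))` points if `s ≤ M` and `r ≤ 2M`. -/
theorem card_le_of_separated_near_sphere {E : Type*} [NormedAddCommGroup E] [NormedSpace ℝ E]
    [FiniteDimensional ℝ E] {d : ℕ} (hd : finrank ℝ E = d + 1) (S : Finset E) {s r M : ℝ}
    (hs : 0 < s) (hr : 0 ≤ r) (hsM : s ≤ M) (hrM : r ≤ 2 * M)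
    (hS : ∀ x ∈ S, ∀ y ∈ S, x ≠ y → s ≤ dist x y) (p : E) (hp : ∀ x ∈ S, |dist x p - r| ≤ s) :
    (S.card : ℝ) ≤ 6 * (d + 1) * 8 ^ d * (M / s) ^ d := by
  have key : (S.card : ℝ) * (s / 2) ^ (d + 1) ≤ (d + 1) * (3 * s) * (4 * M) ^ d := by
    -- The `s/2`-balls about `S` avoid the ball of radius `r - 3s/2` about `p`, so they pack a shell
    -- of thickness at most `3s`.
    set R₁ := max (r - 3 * s / 2) 0 with hR₁
    have h1 : (S.card : ℝ) * (s / 2) ^ (d + 1) + R₁ ^ (d + 1) ≤ (r + 3 * s / 2) ^ (d + 1) := by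
      rcases le_or_gt (r - 3 * s / 2) 0 with h | h
      · rw [hR₁, max_eq_right h, zero_pow d.succ_ne_zero, add_zero]
        have := sum_pow_finrank_le_of_disjoint_balls S id (fun _ => s / 2)
          (fun _ _ => by positivity) (fun i hi j hj hij => by simpa using hS i hi j hj hij)
          p (R := r + 3 * s / 2) (by positivity)
          (fun i hi => by have := abs_le.1 (hp i hi); simp only [id]; linarith)
        simpa [hd] using this
      · rw [hR₁, max_eq_left h.le]
        -- The extra index `none` carries the inner ball.
        have := sum_pow_finrank_le_of_disjoint_balls (Finset.insertNone S) (fun o => o.elim p id)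
          (fun o => o.elim (r - 3 * s / 2) (fun _ => s / 2)) ?_ ?_
          p (R := r + 3 * s / 2) (by positivity) ?_
        · simpa [hd, Finset.insertNone, add_comm] using this
        · rintro (_ | i) hi
          · exact h
          · simpa using hs
        · rintro (_ | i) hi (_ | j) hj hij
          · exact absurd rfl hij
          · have := abs_le.1 (hp j (by simpa using hj))
            simp only [Option.elim, id, dist_comm p j]
            linarith
          · have := abs_le.1 (hp i (by simpa using hi))
            simp only [Option.elim, id]
            linarith
          · simpa using hS i (by simpa using hi) j (by simpa using hj) (by simpa using hij)
        · rintro (_ | i) hi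
          · simp only [Option.elim, dist_self]
            linarith
          · have := abs_le.1 (hp i (by simpa using hi))
            simp only [Option.elim, id]
            linarith
    have hR₁0 : 0 ≤ R₁ := le_max_right _ _
    have hR₁r : r - 3 * s / 2 ≤ R₁ := le_max_left _ _
    have hR₁le : R₁ ≤ r + 3 * s / 2 := max_le (by linarith) (by positivity)
    have h2 := abs_pow_sub_pow_le (r + 3 * s / 2) R₁ (d + 1)
    rw [abs_of_nonneg (sub_nonneg.2 hR₁le), abs_of_nonneg hR₁0,
      abs_of_nonneg (by positivity : 0 ≤ r + 3 * s / 2), max_eq_left hR₁le,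
      Nat.add_sub_cancel] at h2
    have h3 : (r + 3 * s / 2 - R₁) * ((d + 1 : ℕ) : ℝ) * (r + 3 * s / 2) ^ d
        ≤ (3 * s) * ((d + 1 : ℕ) : ℝ) * (4 * M) ^ d := by
      gcongr <;> linarith
    push_cast at h2 h3
    linarith [le_abs_self ((r + 3 * s / 2) ^ (d + 1) - R₁ ^ (d + 1))]
  have h4 : 6 * ((d : ℝ) + 1) * 8 ^ d * (M / s) ^ d
      = (d + 1) * (3 * s) * (4 * M) ^ d / (s / 2) ^ (d + 1) := by
    rw [show (8 : ℝ) = 4 * 2 by norm_num]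
    simp only [mul_pow, div_pow, pow_succ]
    field_simp
    ring
  rw [h4, le_div_iff₀ (by positivity)]
  exact key

/-- A `δ`-separated set of points equidistant from `x ≠ y` and contained in a ball of radius `q`
has `O((q/δ)^(dim - 1))` points. -/
theorem card_le_of_separated_equidistant {E : Type*} [NormedAddCommGroup E]
    [InnerProductSpace ℝ E] [FiniteDimensional ℝ E] {d : ℕ} (hd : finrank ℝ E = d + 1)
    (S : Finset E) {δ q : ℝ} (hδ : 0 < δ) (hq : 0 ≤ q)
    (hS : ∀ x ∈ S, ∀ y ∈ S, x ≠ y → δ ≤ dist x y) (hp : ∀ x ∈ S, ‖x‖ ≤ q)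
    {x y : E} (hxy : x ≠ y) (heq : ∀ p ∈ S, dist p x = dist p y) :
    (S.card : ℝ) ≤ (4 * q / δ + 1) ^ d := by
  classical
  rcases S.eq_empty_or_nonempty with rfl | ⟨p₀, hp₀⟩
  · simp only [Finset.card_empty, Nat.cast_zero]
    positivity
  -- Translating by `p₀` moves the bisector onto a hyperplane through 0, where the packing bound has
  -- exponent `d`.
  let W : Submodule ℝ E := (ℝ ∙ (y - x))ᗮ
  have hW : finrank ℝ W = d := by
    have : Fact (finrank ℝ E = d + 1) := ⟨hd⟩
    exact Submodule.finrank_orthogonal_span_singleton (sub_ne_zero.2 hxy.symm)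
  have hmem : ∀ p ∈ S, p - p₀ ∈ W := by
    intro p hp'
    have h1 : p ∈ AffineSubspace.perpBisector x y :=
      AffineSubspace.mem_perpBisector_iff_dist_eq.2 (heq p hp')
    have h2 : p₀ ∈ AffineSubspace.perpBisector x y :=
      AffineSubspace.mem_perpBisector_iff_dist_eq.2 (heq p₀ hp₀)
    have h3 := AffineSubspace.vsub_mem_direction h1 h2
    rwa [AffineSubspace.direction_perpBisector] at h3
  let f : S → W := fun p => ⟨p.1 - p₀, hmem p.1 p.2⟩
  have hdist : ∀ a b : S, dist (f a) (f b) = dist (a : E) b := fun a b => by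
    rw [Subtype.dist_eq]
    exact dist_sub_right _ _ _
  have hinj : Function.Injective f := fun a b hab => by
    rw [← dist_eq_zero, hdist] at hab
    exact Subtype.ext (dist_eq_zero.1 hab)
  have := card_le_of_separated (Finset.univ.image f) hδ (R := 2 * q) (by positivity) ?_ 0 ?_
  · rw [Finset.card_image_of_injective _ hinj, hW] at this
    simpa [← mul_assoc, show (2 : ℝ) * 2 = 4 by norm_num] using this
  · simp only [Finset.mem_image, Finset.mem_univ, true_and, forall_exists_index,
      forall_apply_eq_imp_iff]
    intro a b hab
    rw [hdist]
    exact hS _ b.2 _ a.2 (fun h => hab (by rw [Subtype.ext h])) |>.trans_eq (dist_comm _ _)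
  · simp only [Finset.mem_image, Finset.mem_univ, true_and, forall_exists_index,
      forall_apply_eq_imp_iff]
    intro a
    have h1 : dist (f a) 0 = ‖(a : E) - p₀‖ := by simp [f]
    rw [h1]
    linarith [norm_sub_le (a : E) p₀, hp a a.2, hp p₀ hp₀]

/-! ### Rounding and collisions -/

/-- Every finite set can be rounded, at scale `s`, to an `s`-separated subset of itself. -/
theorem exists_separated_rounding {X : Type*} [MetricSpace X] (P : Finset X) {s : ℝ}
    (hs : 0 < s) :
    ∃ g : X → X, (∀ x ∈ P, dist x (g x) ≤ s) ∧
      ∀ x ∈ P, ∀ y ∈ P, g x ≠ g y → s ≤ dist (g x) (g y) := by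
  classical
  -- A separated subset of maximal cardinality is an `s`-net: a point far from it could be added.
  let F := P.powerset.filter (fun T => ∀ x ∈ T, ∀ y ∈ T, x ≠ y → s ≤ dist x y)
  have hF : F.Nonempty := ⟨∅, by simp [F]⟩
  obtain ⟨T, hT, hmax⟩ := F.exists_max_image Finset.card hF
  obtain ⟨hTP, hsep⟩ := Finset.mem_filter.1 hT
  rw [Finset.mem_powerset] at hTP
  have hcov : ∀ x ∈ P, ∃ t ∈ T, dist x t ≤ s := by
    intro x hx
    by_contra! hfar
    have hxT : x ∉ T := fun h => by
      have := hfar x h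
      rw [dist_self] at this
      linarith
    have hins : insert x T ∈ F := by
      refine Finset.mem_filter.2 ⟨Finset.mem_powerset.2 (Finset.insert_subset hx hTP), ?_⟩
      intro a ha b hb hab
      rcases Finset.mem_insert.1 ha with rfl | haT <;>
        rcases Finset.mem_insert.1 hb with rfl | hbT
      · exact absurd rfl hab
      · exact (hfar b hbT).le
      · rw [dist_comm]
        exact (hfar a haT).le
      · exact hsep a haT b hbT hab
    have := hmax _ hins
    rw [Finset.card_insert_of_notMem hxT] at this
    omega
  choose! g hg using hcov
  exact ⟨g, fun x hx => (hg x hx).2, fun x hx y hy => hsep _ (hg x hx).1 _ (hg y hy).1⟩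

/-- The number of points is at most the number of values of a function plus the number of its
ordered collisions. -/
theorem card_le_card_image_add_card_collisions {α β : Type*} [DecidableEq α] [DecidableEq β]
    (P : Finset α) (f : α → β) :
    P.card ≤ (P.image f).card + (P.offDiag.filter (fun z => f z.1 = f z.2)).card := by
  rcases P.eq_empty_or_nonempty with rfl | ⟨a₀, -⟩
  · simp
  have : Nonempty α := ⟨a₀⟩
  have hrep : ∀ b ∈ P.image f, ∃ a ∈ P, f a = b := fun b hb => Finset.mem_image.1 hb
  choose! g hgP hg using hrep
  -- `g` picks one representative per fibre; every other point collides with its representative.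
  have h1 := Finset.card_filter_add_card_filter_not (s := P) (fun x => x = g (f x))
  have h2 : (P.filter (fun x => x = g (f x))).card ≤ (P.image f).card := by
    refine Finset.card_le_card_of_injOn f (fun x hx => ?_) (fun x hx y hy hxy => ?_)
    · exact Finset.mem_image_of_mem f (Finset.mem_filter.1 hx).1
    · rw [(Finset.mem_filter.1 hx).2, (Finset.mem_filter.1 hy).2, hxy]
  have h3 : (P.filter (fun x => ¬ x = g (f x))).card
      ≤ (P.offDiag.filter (fun z => f z.1 = f z.2)).card := by
    refine Finset.card_le_card_of_injOn (fun x => (x, g (f x))) (fun x hx => ?_)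
      (fun x _ y _ hxy => (Prod.ext_iff.1 hxy).1)
    obtain ⟨hxP, hne⟩ := Finset.mem_filter.1 hx
    have hfx := Finset.mem_image_of_mem f hxP
    exact Finset.mem_filter.2
      ⟨Finset.mem_offDiag.2 ⟨hxP, hgP _ hfx, hne⟩, (hg _ hfx).symm⟩
  omega

/-! ### Double counting of collisions -/

/-- The incidence inequality behind the distance bound: a `δ`-separated set of points of norm at
most `q`, rounded at scale `s ≤ q`. -/
theorem card_le_card_distances_mul_add {E : Type*} [NormedAddCommGroup E]
    [InnerProductSpace ℝ E] [FiniteDimensional ℝ E] {d : ℕ} (hd : finrank ℝ E = d + 1)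
    (P : Finset E) (Δ : Finset ℝ) {δ s q : ℝ} (hδ : 0 < δ) (hs : 0 < s) (hsq : s ≤ q)
    (hP : ∀ x ∈ P, ∀ y ∈ P, x ≠ y → δ ≤ dist x y) (hq : ∀ x ∈ P, ‖x‖ ≤ q)
    (hΔ : ∀ x ∈ P, ∀ y ∈ P, dist x y ∈ Δ) :
    (P.card : ℝ) ≤ Δ.card * (6 * (d + 1) * 8 ^ d * (q / s) ^ d) +
      (2 * s / δ + 1) ^ (d + 1) * (4 * q / δ + 1) ^ d := by
  classical
  rcases P.eq_empty_or_nonempty with rfl | hne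
  · have : 0 < q := hs.trans_le hsq
    simp only [Finset.card_empty, Nat.cast_zero]
    positivity
  have hq0 : 0 < q := hs.trans_le hsq
  set K₁ : ℝ := 6 * (d + 1) * 8 ^ d * (q / s) ^ d
  set K₂ : ℝ := (2 * s / δ + 1) ^ (d + 1)
  set K₃ : ℝ := (4 * q / δ + 1) ^ d
  obtain ⟨g, hg, hgsep⟩ := exists_separated_rounding P hs
  let f : E → E → E × ℝ := fun p x => (g x, dist x p)
  have himage : ∀ p ∈ P, ((P.image (f p)).card : ℝ) ≤ Δ.card * K₁ := by
    intro p hp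
    have hmaps : ∀ z ∈ P.image (f p), z.2 ∈ Δ := by
      intro z hz
      obtain ⟨x, hx, rfl⟩ := Finset.mem_image.1 hz
      exact hΔ x hx p hp
    rw [Finset.card_eq_sum_card_fiberwise hmaps, Nat.cast_sum, ← nsmul_eq_mul]
    refine Finset.sum_le_card_nsmul _ _ _ fun r _ => ?_
    set Z := (P.image (f p)).filter (fun z => z.2 = r)
    rcases Z.eq_empty_or_nonempty with hZ | ⟨z₀, hz₀⟩
    · rw [hZ, Finset.card_empty, Nat.cast_zero]
      positivity
    have hZ : ∀ z ∈ Z, ∃ x ∈ P, g x = z.1 ∧ dist x p = r := by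
      intro z hz
      obtain ⟨hz1, hz2⟩ := Finset.mem_filter.1 hz
      obtain ⟨x, hx, rfl⟩ := Finset.mem_image.1 hz1
      exact ⟨x, hx, rfl, hz2⟩
    have hinj : Set.InjOn Prod.fst (Z : Set (E × ℝ)) := fun a ha b hb hab =>
      Prod.ext hab ((Finset.mem_filter.1 ha).2.trans (Finset.mem_filter.1 hb).2.symm)
    rw [← Finset.card_image_of_injOn hinj]
    obtain ⟨x₀, hx₀, -, hr₀⟩ := hZ z₀ hz₀
    refine card_le_of_separated_near_sphere hd _ (r := r) hs (hr₀ ▸ dist_nonneg) hsq ?_ ?_ p ?_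
    · rw [← hr₀, dist_eq_norm]
      linarith [norm_sub_le x₀ p, hq x₀ hx₀, hq p hp]
    · intro a ha b hb hab
      obtain ⟨z, hz, rfl⟩ := Finset.mem_image.1 ha
      obtain ⟨w, hw, rfl⟩ := Finset.mem_image.1 hb
      obtain ⟨x, hx, hxz, -⟩ := hZ z hz
      obtain ⟨y, hy, hyw, -⟩ := hZ w hw
      rw [← hxz, ← hyw] at hab ⊢
      exact hgsep x hx y hy hab
    · intro a ha
      obtain ⟨z, hz, rfl⟩ := Finset.mem_image.1 ha
      obtain ⟨x, hx, hxz, hxr⟩ := hZ z hz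
      rw [← hxz, ← hxr]
      refine (abs_dist_sub_le (g x) x p).trans ?_
      rw [dist_comm]
      exact hg x hx
  have hcell : ∀ x ∈ P, ((P.filter (fun y => g x = g y)).card : ℝ) ≤ K₂ := by
    intro x hx
    simp only [K₂, ← hd]
    refine card_le_of_separated _ hδ hs.le (fun a ha b hb => hP a (Finset.mem_filter.1 ha).1 b
      (Finset.mem_filter.1 hb).1) (g x) (fun a ha => ?_)
    rw [(Finset.mem_filter.1 ha).2]
    exact hg a (Finset.mem_filter.1 ha).1
  let N := P.offDiag.filter (fun z => g z.1 = g z.2)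
  have hN : (N.card : ℝ) ≤ P.card * K₂ := by
    have hmaps : ∀ z ∈ N, z.1 ∈ P := fun z hz =>
      (Finset.mem_offDiag.1 (Finset.mem_filter.1 hz).1).1
    rw [Finset.card_eq_sum_card_fiberwise hmaps, Nat.cast_sum, ← nsmul_eq_mul]
    refine Finset.sum_le_card_nsmul _ _ _ fun x hx => le_trans ?_ (hcell x hx)
    rw [Nat.cast_le]
    refine Finset.card_le_card_of_injOn Prod.snd (fun z hz => ?_) (fun z hz w hw hzw => ?_)
    · obtain ⟨hz1, rfl⟩ := Finset.mem_filter.1 hz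
      obtain ⟨hz2, hz3⟩ := Finset.mem_filter.1 hz1
      exact Finset.mem_filter.2 ⟨(Finset.mem_offDiag.1 hz2).2.1, hz3⟩
    · exact Prod.ext ((Finset.mem_filter.1 hz).2.trans (Finset.mem_filter.1 hw).2.symm) hzw
  have hcoll : ∀ p, P.offDiag.filter (fun z => f p z.1 = f p z.2)
      = N.filter (fun z => dist p z.1 = dist p z.2) := by
    intro p
    ext z
    simp only [N, f, Finset.mem_filter, Prod.mk.injEq, dist_comm p, and_assoc]
  have hdouble : ∑ p ∈ P, ((P.offDiag.filter (fun z => f p z.1 = f p z.2)).card : ℝ)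
      ≤ P.card * K₂ * K₃ := by
    -- Count by pairs instead: the pairs in `N` do not depend on `p`, and each meets only the `p` on
    -- its bisector.
    have hswap : ∑ p ∈ P, (P.offDiag.filter (fun z => f p z.1 = f p z.2)).card
        = ∑ z ∈ N, (P.filter (fun p => dist p z.1 = dist p z.2)).card := by
      simp only [hcoll]
      exact Finset.sum_card_bipartiteAbove_eq_sum_card_bipartiteBelow
        (fun (p : E) (z : E × E) => dist p z.1 = dist p z.2)
    rw [← Nat.cast_sum, hswap, Nat.cast_sum]
    calc ∑ z ∈ N, ((P.filter (fun p => dist p z.1 = dist p z.2)).card : ℝ)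
        ≤ ∑ _z ∈ N, K₃ := by
          refine Finset.sum_le_sum fun z hz => ?_
          have hne := (Finset.mem_offDiag.1 (Finset.mem_filter.1 hz).1).2.2
          exact card_le_of_separated_equidistant hd _ hδ hq0.le
            (fun a ha b hb => hP a (Finset.mem_filter.1 ha).1 b (Finset.mem_filter.1 hb).1)
            (fun a ha => hq a (Finset.mem_filter.1 ha).1) hne
            (fun a ha => (Finset.mem_filter.1 ha).2)
      _ = N.card * K₃ := by rw [Finset.sum_const, nsmul_eq_mul]
      _ ≤ P.card * K₂ * K₃ := by gcongr
  have htotal : (P.card : ℝ) * P.card ≤ P.card * (Δ.card * K₁ + K₂ * K₃) := by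
    calc (P.card : ℝ) * P.card = ∑ _p ∈ P, (P.card : ℝ) := by
          rw [Finset.sum_const, nsmul_eq_mul]
      _ ≤ ∑ p ∈ P, (Δ.card * K₁ +
            ((P.offDiag.filter (fun z => f p z.1 = f p z.2)).card : ℝ)) := by
          refine Finset.sum_le_sum fun p hp => ?_
          have h := card_le_card_image_add_card_collisions P (f p)
          have h' : (P.card : ℝ) ≤ (P.image (f p)).card +
              ((P.offDiag.filter (fun z => f p z.1 = f p z.2)).card : ℝ) := by exact_mod_cast h
          linarith [himage p hp]
      _ ≤ P.card * (Δ.card * K₁ + K₂ * K₃) := by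
          rw [Finset.sum_add_distrib, Finset.sum_const, nsmul_eq_mul]
          linarith
  exact le_of_mul_le_mul_left htotal (by exact_mod_cast hne.card_pos)

/-! ### Size of the truncations -/

/-- If the open `D`-balls about finitely many points cover the ball of radius `R` about the origin,
then there are at least `(R/D)^dim` points. -/
theorem le_card_of_covering {E : Type*} [NormedAddCommGroup E] [NormedSpace ℝ E]
    [FiniteDimensional ℝ E] (P : Finset E) {D R : ℝ} (hD : 0 < D) (hR : 0 < R)
    (hP : ∀ y : E, ‖y‖ < R → ∃ x ∈ P, dist y x < D) :
    (R / D) ^ finrank ℝ E ≤ P.card := by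
  let _ : MeasurableSpace E := borel E
  have : BorelSpace E := ⟨rfl⟩
  let μ : Measure E := Measure.addHaar
  have hpos : μ (Metric.ball (0 : E) 1) ≠ 0 := (Metric.measure_ball_pos μ 0 one_pos).ne'
  have hfin : μ (Metric.ball (0 : E) 1) ≠ ⊤ := measure_ball_lt_top.ne
  have h1 : μ (Metric.ball 0 R) ≤ ∑ x ∈ P, μ (Metric.ball x D) := by
    refine (measure_mono fun y hy => ?_).trans (measure_biUnion_finset_le P _)
    obtain ⟨x, hx, hyx⟩ := hP y (by simpa using hy)
    exact Set.mem_iUnion₂.2 ⟨x, hx, hyx⟩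
  rw [Measure.addHaar_ball_of_pos μ 0 hR,
    Finset.sum_congr rfl (fun x _ => Measure.addHaar_ball_of_pos μ x hD),
    ← Finset.sum_mul, ENNReal.mul_le_mul_iff_left hpos hfin,
    ← ENNReal.ofReal_sum_of_nonneg (fun i hi => (pow_pos hD _).le),
    ENNReal.ofReal_le_ofReal_iff (Finset.sum_nonneg fun _ _ => (pow_pos hD _).le),
    Finset.sum_const, nsmul_eq_mul] at h1
  rw [div_pow, div_le_iff₀ (by positivity)]
  exact h1

namespace IsWellDistributed

variable {d : ℕ} {c C : ℝ} {A : Set (EuclideanSpace ℝ (Fin d))}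

theorem card_le (hA : IsWellDistributed c C A) (hc : 0 < c) {q : ℝ} (hq : 0 ≤ q)
    (S : Finset (EuclideanSpace ℝ (Fin d))) (hS : (S : Set _) ⊆ truncation A q) :
    (S.card : ℝ) ≤ (2 * q / c + 1) ^ d := by
  have := card_le_of_separated S hc hq (fun x hx y hy hxy => by
    rw [dist_eq_norm]
    exact hA.separated x (hS hx).1 y (hS hy).1 hxy) 0 (fun x hx => (hS hx).2.le)
  rwa [finrank_euclideanSpace_fin] at this

theorem finite_truncation (hA : IsWellDistributed c C A) (hc : 0 < c) {q : ℝ} (hq : 0 ≤ q) :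
    (truncation A q).Finite := by
  by_contra hinf
  obtain ⟨n, hn⟩ := exists_nat_gt ((2 * q / c + 1) ^ d)
  obtain ⟨S, hS, hSn⟩ := Set.Infinite.exists_subset_card_eq hinf n
  have := hA.card_le hc hq S hS
  rw [hSn] at this
  linarith

theorem exists_dist_lt (hA : IsWellDistributed c C A) (hC : 0 < C)
    (y : EuclideanSpace ℝ (Fin d)) : ∃ a ∈ A, dist y a < (d + 1) * C := by
  obtain ⟨a, ha, hya⟩ := hA.meets_cubes y
  refine ⟨a, ha, ?_⟩
  rw [EuclideanSpace.dist_eq, Real.sqrt_lt' (by positivity)]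
  calc ∑ i, dist (y i) (a i) ^ 2 ≤ ∑ _i : Fin d, C ^ 2 := by
        refine Finset.sum_le_sum fun i _ => ?_
        have := hya i
        rw [Real.dist_eq]
        exact pow_le_pow_left₀ (abs_nonneg _) (abs_le.2 ⟨by linarith, by linarith⟩) 2
    _ = d * C ^ 2 := by simp
    _ < ((d + 1) * C) ^ 2 := by
        rw [mul_pow]
        gcongr
        nlinarith [(Nat.cast_nonneg d : (0 : ℝ) ≤ d)]

/-- The radius drops by `(d + 1) * C` so that the nearby points of `A` stay inside the ball of
radius `q`. -/
theorem le_card (hA : IsWellDistributed c C A) (hC : 0 < C) {q : ℝ}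
    (hq : (d + 1) * C < q) (S : Finset (EuclideanSpace ℝ (Fin d)))
    (hS : (S : Set _) = truncation A q) :
    ((q - (d + 1) * C) / ((d + 1) * C)) ^ d ≤ S.card := by
  have := le_card_of_covering S (D := (d + 1) * C) (R := q - (d + 1) * C) (by positivity)
    (by linarith) (fun y hy => ?_)
  · rwa [finrank_euclideanSpace_fin] at this
  · obtain ⟨a, ha, hya⟩ := hA.exists_dist_lt hC y
    refine ⟨a, ?_, hya⟩
    rw [← Finset.mem_coe, hS]
    refine ⟨ha, ?_⟩
    rw [mem_ball_zero_iff]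
    rw [dist_eq_norm] at hya
    linarith [norm_le_norm_add_norm_sub' a y, norm_sub_rev a y]

end IsWellDistributed

/-! ### Choice of scale -/

/-- Optimising the scale `s` in the incidence inequality: it is taken of order `q ^ (1 / d)`. -/
theorem exists_mul_rpow_le_of_scale_inequality (k : ℕ) {c D : ℝ} (hc : 0 < c) (hD : 0 < D) :
    ∃ q₀ : ℝ, D < q₀ ∧ ∃ κ : ℝ, 0 < κ ∧ ∀ q n t : ℝ, q₀ ≤ q → 0 ≤ n →
      ((q - D) / D) ^ (k + 1) ≤ n → n ≤ (2 * q / c + 1) ^ (k + 1) →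
      (∀ s, 0 < s → s ≤ q → n ≤ t * (6 * (k + 1) * 8 ^ k * (q / s) ^ k) +
        (2 * s / c + 1) ^ (k + 1) * (4 * q / c + 1) ^ k) →
      κ * n ^ (((2 * k + 1 : ℕ) : ℝ) / ((k + 1 : ℕ) : ℝ) ^ 2) ≤ t := by
  set e : ℝ := ((2 * k + 1 : ℕ) : ℝ) / ((k + 1 : ℕ) : ℝ) ^ 2 with he
  have he0 : 0 ≤ e := by positivity
  obtain ⟨a, ha⟩ : ∃ a : ℝ, a = (1 / (2 * D)) ^ (k + 1) := ⟨_, rfl⟩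
  have ha0 : 0 < a := by rw [ha]; positivity
  obtain ⟨b, hb⟩ : ∃ b : ℝ, b = (3 / c) ^ (k + 1) * (5 / c) ^ k := ⟨_, rfl⟩
  have hb0 : 0 < b := by rw [hb]; positivity
  obtain ⟨M, hM⟩ : ∃ M : ℝ, M = 6 * (k + 1) * 8 ^ k := ⟨_, rfl⟩
  have hM0 : 0 < M := by rw [hM]; positivity
  obtain ⟨B, hB⟩ : ∃ B : ℝ, B = ((3 / c) ^ (k + 1)) ^ e := ⟨_, rfl⟩
  have hB0 : 0 < B := by rw [hB]; positivity
  -- Chosen so that the collision term is at most half of the lower bound `a * q ^ (k + 1)` for `n`.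
  obtain ⟨ε, hε⟩ : ∃ ε : ℝ, ε = min 1 (a / (2 * b)) := ⟨_, rfl⟩
  have hε0 : 0 < ε := by rw [hε]; positivity
  have hε1 : ε ≤ 1 := hε ▸ min_le_left _ _
  have hεb : ε * (2 * b) ≤ a := by
    rw [← le_div_iff₀ (by positivity)]
    exact hε ▸ min_le_right _ _
  -- `2D ≤ q` gives `q - D ≥ q/2`; the bounds with `c` absorb each `+ 1`; `1 ≤ q` gives `s ≤ q`.
  refine ⟨max (max 1 c) (max (2 * D) ((c / ε) ^ (k + 1))),
    lt_max_of_lt_right (lt_max_of_lt_left (by linarith)),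
    a * ε ^ k / (2 * M * B), by positivity, ?_⟩
  intro q n t hq hn0 hn hn' hscale
  obtain ⟨⟨hq1, hqc⟩, hqD, hqε⟩ : (1 ≤ q ∧ c ≤ q) ∧ 2 * D ≤ q ∧ (c / ε) ^ (k + 1) ≤ q := by
    simpa only [max_le_iff] using hq
  have hq0 : 0 < q := one_pos.trans_le hq1
  obtain ⟨u, hu0, huq⟩ : ∃ u : ℝ, 0 < u ∧ u ^ (k + 1) = q :=
    ⟨q ^ (((k + 1 : ℕ) : ℝ)⁻¹), by positivity, Real.rpow_inv_natCast_pow hq0.le k.succ_ne_zero⟩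
  have hu1 : 1 ≤ u := by
    by_contra! h
    exact absurd (pow_lt_one₀ hu0.le h k.succ_ne_zero) (by rw [huq]; exact not_lt.2 hq1)
  have huε : c / ε ≤ u := le_of_pow_le_pow_left₀ k.succ_ne_zero hu0.le (hqε.trans huq.ge)
  have hcs : c ≤ ε * u := by rwa [div_le_iff₀' hε0] at huε
  have huq' : u ≤ q := huq ▸ le_self_pow₀ hu1 k.succ_ne_zero
  have hsq : ε * u ≤ q := by nlinarith
  have hs0 : 0 < ε * u := by positivity
  have h1 := hscale (ε * u) hs0 hsq
  have hlow : a * q ^ (k + 1) ≤ n := by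
    refine le_trans ?_ hn
    rw [ha, ← mul_pow]
    gcongr
    rw [one_div_mul_eq_div, div_le_div_iff₀ (by positivity) hD]
    nlinarith
  have h2 : 2 * (ε * u) / c + 1 ≤ 3 / c * (ε * u) := by
    have : 1 ≤ ε * u / c := (one_le_div hc).2 hcs
    have e1 : 2 * (ε * u) / c = 2 * (ε * u / c) := by ring
    have e2 : 3 / c * (ε * u) = 3 * (ε * u / c) := by ring
    linarith
  have h3 : 4 * q / c + 1 ≤ 5 / c * q := by
    have : 1 ≤ q / c := (one_le_div hc).2 hqc
    have e1 : 4 * q / c = 4 * (q / c) := by ring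
    have e2 : 5 / c * q = 5 * (q / c) := by ring
    linarith
  have h4 : 2 * q / c + 1 ≤ 3 / c * q := by
    have : 1 ≤ q / c := (one_le_div hc).2 hqc
    have e1 : 2 * q / c = 2 * (q / c) := by ring
    have e2 : 3 / c * q = 3 * (q / c) := by ring
    linarith
  have h5 : (2 * (ε * u) / c + 1) ^ (k + 1) * (4 * q / c + 1) ^ k ≤ a / 2 * q ^ (k + 1) := by
    calc (2 * (ε * u) / c + 1) ^ (k + 1) * (4 * q / c + 1) ^ k
        ≤ (3 / c * (ε * u)) ^ (k + 1) * (5 / c * q) ^ k := by gcongr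
      _ = b * ε ^ (k + 1) * (u ^ (k + 1) * q ^ k) := by
          rw [hb]
          simp only [mul_pow]
          ring
      _ ≤ b * ε * (q * q ^ k) := by
          rw [huq]
          gcongr
          exact pow_le_of_le_one hε0.le hε1 k.succ_ne_zero
      _ ≤ a / 2 * (q * q ^ k) := by
          gcongr
          linarith
      _ = a / 2 * q ^ (k + 1) := by rw [pow_succ']
  have h6 : a / 2 * q ^ (k + 1) ≤ t * (M * (q / (ε * u)) ^ k) := by
    rw [hM]
    linarith
  have h7 : a / 2 * ε ^ k * u ^ (2 * k + 1) ≤ t * M := by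
    rw [div_pow, ← mul_div_assoc, ← mul_div_assoc, le_div_iff₀ (by positivity)] at h6
    refine le_of_mul_le_mul_right ?_ (pow_pos hq0 k)
    calc a / 2 * ε ^ k * u ^ (2 * k + 1) * q ^ k
        = a / 2 * (u ^ (k + 1) * q ^ k) * (ε * u) ^ k := by
          rw [mul_pow]
          ring
      _ = a / 2 * q ^ (k + 1) * (ε * u) ^ k := by rw [huq, ← pow_succ']
      _ ≤ t * M * q ^ k := by linarith
  have h8 : n ^ e ≤ B * u ^ (2 * k + 1) := by
    calc n ^ e ≤ ((3 / c * q) ^ (k + 1)) ^ e :=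
          Real.rpow_le_rpow hn0 (hn'.trans (by gcongr)) he0
      _ = B * (u ^ ((k + 1) * (k + 1))) ^ e := by
          rw [hB, mul_pow, Real.mul_rpow (by positivity) (by positivity), ← huq, ← pow_mul]
      _ = B * u ^ (2 * k + 1) := by
          rw [← Real.rpow_natCast u, ← Real.rpow_mul hu0.le, ← Real.rpow_natCast u (2 * k + 1)]
          congr 2
          rw [he]
          push_cast
          field_simp
  calc a * ε ^ k / (2 * M * B) * n ^ e
      ≤ a * ε ^ k / (2 * M * B) * (B * u ^ (2 * k + 1)) := by gcongr
    _ = a / 2 * ε ^ k * u ^ (2 * k + 1) / M := by field_simp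
    _ ≤ t := by rwa [div_le_iff₀ hM0]

/-! ### Conclusion -/

theorem distanceSet_eq_image2 {d : ℕ} (E : Set (EuclideanSpace ℝ (Fin d))) :
    distanceSet E = Set.image2 dist E E := by
  ext r
  simp only [distanceSet, Set.mem_ofPred_eq, Set.mem_image2, dist_eq_norm, eq_comm]

theorem corollary1p2 (d : ℕ) (hd : 1 ≤ d) (c C : ℝ) (hc : 0 < c) (hC : 0 < C) :
    ∃ κ : ℝ, 0 < κ ∧
      ∀ A : Set (EuclideanSpace ℝ (Fin d)), IsWellDistributed c C A →
        ∀ q : ℝ, 0 < q →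
          (truncation A q).Finite ∧
          κ * ((truncation A q).ncard : ℝ) ^ ((2 : ℝ) / (d : ℝ) - 1 / (d : ℝ) ^ 2) ≤
            ((distanceSet (truncation A q)).ncard : ℝ) := by
  obtain ⟨k, rfl⟩ : ∃ k, d = k + 1 := ⟨d - 1, by omega⟩
  have hexp : (2 : ℝ) / ((k + 1 : ℕ) : ℝ) - 1 / ((k + 1 : ℕ) : ℝ) ^ 2
      = ((2 * k + 1 : ℕ) : ℝ) / ((k + 1 : ℕ) : ℝ) ^ 2 := by
    push_cast
    field_simp
    ring
  rw [hexp]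
  have hD : 0 < (((k + 1 : ℕ) : ℝ) + 1) * C := by positivity
  obtain ⟨q₀, hq₀D, κ, hκ, hlarge⟩ := exists_mul_rpow_le_of_scale_inequality k hc hD
  have hq₀ : 0 < q₀ := hD.trans hq₀D
  set e : ℝ := ((2 * k + 1 : ℕ) : ℝ) / ((k + 1 : ℕ) : ℝ) ^ 2 with he
  have he0 : 0 < e := by positivity
  set N₀ : ℝ := (2 * q₀ / c + 1) ^ (k + 1)
  have hN₀ : 0 < N₀ ^ e := by positivity
  -- The second entry serves `q < q₀`: there `n ≤ N₀`, and the distance 0 alone suffices if `n > 0`.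
  refine ⟨min κ (N₀ ^ e)⁻¹, lt_min hκ (inv_pos.2 hN₀), fun A hA q hq => ?_⟩
  have hfin := hA.finite_truncation hc hq.le
  refine ⟨hfin, ?_⟩
  obtain ⟨P, hP⟩ := hfin.exists_finset_coe
  have hΔfin : (distanceSet (truncation A q)).Finite := by
    rw [distanceSet_eq_image2]
    exact hfin.image2 _ hfin
  obtain ⟨Δ, hΔ⟩ := hΔfin.exists_finset_coe
  have hmem : ∀ x ∈ P, ∀ y ∈ P, dist x y ∈ Δ := by
    intro x hx y hy
    rw [← Finset.mem_coe, hΔ, distanceSet_eq_image2, ← hP]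
    exact ⟨x, hx, y, hy, rfl⟩
  rw [← hΔ, ← hP, Set.ncard_coe_finset, Set.ncard_coe_finset]
  have hupper := hA.card_le hc hq.le P hP.le
  rcases le_or_gt q₀ q with hqq | hqq
  · refine le_trans ?_ (hlarge q P.card Δ.card hqq (Nat.cast_nonneg _)
      (hA.le_card hC (hq₀D.trans_le hqq) P hP) hupper fun s hs hsq => ?_)
    · gcongr
      exact min_le_left _ _
    · refine card_le_card_distances_mul_add (by simp) P Δ hc hs hsq ?_ ?_ hmem
      · intro x hx y hy hxy
        rw [← Finset.mem_coe, hP] at hx hy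
        rw [dist_eq_norm]
        exact hA.separated x hx.1 y hy.1 hxy
      · intro x hx
        rw [← Finset.mem_coe, hP] at hx
        exact (mem_ball_zero_iff.1 hx.2).le
  · rcases P.eq_empty_or_nonempty with hPe | ⟨x, hx⟩
    · rw [hPe, Finset.card_empty, Nat.cast_zero, Real.zero_rpow he0.ne', mul_zero]
      positivity
    · have h1 : (1 : ℝ) ≤ Δ.card := by
        exact_mod_cast Finset.card_pos.2 ⟨_, hmem x hx x hx⟩
      refine le_trans ?_ h1
      calc min κ (N₀ ^ e)⁻¹ * (P.card : ℝ) ^ e ≤ (N₀ ^ e)⁻¹ * N₀ ^ e := by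
            gcongr
            · exact min_le_right _ _
            · exact hupper.trans (by simp only [N₀]; gcongr)
        _ = 1 := inv_mul_cancel₀ hN₀.ne'
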